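/- Let $K\subset\mathbb{R}$ be a number field, let $\theta\in(0,\pi)$ be an angle with $\cos\theta=s/r$ for coprime integers $r>0$ and $s$, and let $n$ be a positive integer. A $(K,\theta)$-triangle for $n$ is a triple $(u,v,w)\in K^3$ of side lengths of a (nondegenerate) triangle in which the sides $u$ and $v$ enclose the angle $\theta$ and whose area is $n\sqrt{r^2-s^2}$. The number $n$ is called $(K,\theta)$-congruent if there is a $(K,\theta)$-triangle for $n$, and properly $(K,\theta)$-congruent if there are infinitely many. (i) The number $n=1$ is $(\mathbb{Q}(\sqrt3),2\pi/3)$-congruent but not properly $(\mathbb{Q}(\sqrt3),2\pi/3)$-congruent. (ii) The number $n=3$ is properly $(\mathbb{Q}(\sqrt{13}),\pi/3)$-congruent, and $\left(\frac{\sqrt{13}}{2},\frac{24\sqrt{13}}{13},\frac{43\sqrt{13}}{26}\right)$ is a $(\mathbb{Q}(\sqrt{13}),\pi/3)$-triangle for $3$. (iii) The number $n=2$ is properly $(\mathbb{Q}(\sqrt7),2\pi/3)$-congruent, and $\left(\frac{3\sqrt7}{7},\frac{8\sqrt7}{3},\frac{61\sqrt7}{21}\right)$ is a $(\mathbb{Q}(\sqrt7),2\pi/3)$-triangle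 for $2$. (iv) The number $n=6$ is properly $(\mathbb{Q}(\sqrt5),\pi/3)$-congruent, and $\left(\frac{8\sqrt5}{5},3\sqrt5,\frac{13\sqrt5}{5}\right)$ is a $(\mathbb{Q}(\sqrt5),\pi/3)$-triangle for $6$. -/

import Mathlib

open Real EuclideanGeometry
open scoped IntermediateField

/-- The area of the plane triangle `A B C`: half the product of the two sides meeting at `C`
and the sine of the angle between them. -/
noncomputable def triangleArea (A B C : EuclideanSpace ℝ (Fin 2)) : ℝ :=
  dist C A * dist C B * Real.sin (∠ A C B) / 2

/-- `u`, `v`, `w` are the side lengths of a nondegenerate plane triangle in which the sides `u`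
and `v` enclose the angle `θ`, and whose area is `a`. -/
def IsTriangleWith (θ a u v w : ℝ) : Prop :=
  ∃ A B C : EuclideanSpace ℝ (Fin 2), AffineIndependent ℝ ![A, B, C] ∧
    dist C A = u ∧ dist C B = v ∧ dist A B = w ∧ ∠ A C B = θ ∧ triangleArea A B C = a

/-- The set of `(K, θ)`-triangles for `n`, where `K` is a real field and `θ` is an angle with
`cos θ = s / r` in lowest terms: all `(u, v, w)` in `K³` that are the sides of a triangle with
angle `θ` between `u` and `v` and with area `n √(r² - s²)`. -/
def thetaTriangles (K : IntermediateField ℚ ℝ) (θ : ℝ) (n : ℕ) : Set (ℝ × ℝ × ℝ) :=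
  {t | t.1 ∈ K ∧ t.2.1 ∈ K ∧ t.2.2 ∈ K ∧
    ∃ r s : ℤ, 0 < r ∧ IsCoprime r s ∧ Real.cos θ = (s : ℝ) / (r : ℝ) ∧
      IsTriangleWith θ ((n : ℝ) * √((r : ℝ) ^ 2 - (s : ℝ) ^ 2)) t.1 t.2.1 t.2.2}

/-- `n` is `(K, θ)`-congruent: there is a `(K, θ)`-triangle for `n`. -/
def IsThetaCongruent (K : IntermediateField ℚ ℝ) (θ : ℝ) (n : ℕ) : Prop :=
  (thetaTriangles K θ n).Nonempty

/-- `n` is properly `(K, θ)`-congruent: there are infinitely many `(K, θ)`-triangles for `n`. -/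
def IsProperlyThetaCongruent (K : IntermediateField ℚ ℝ) (θ : ℝ) (n : ℕ) : Prop :=
  (thetaTriangles K θ n).Infinite

/-! Put ε = -2 cos θ, which is 1 at 2π/3 and -1 at π/3. The law of cosines and the area formula turn
a triangle for n into positive u, v, w with uv = 4n and w² = u² + v² + 4εn. Then x = w²/4, x +
(2-ε)n = ((u+v)/2)² and x - (2+ε)n = ((u-v)/2)² are squares: a triangle is a point on an elliptic
curve with full 2-torsion whose three linear factors are squares.

Infinitude: dividing by √d makes the given triangles rational, with n replaced by N = n/d. Doubling
the point doubles the 2-adic norm of W (`exists_double_mem_scaledTriangles`), so the known triangle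
generates infinitely many.

Finiteness for n = 1 over ℚ(√3): a = w/2, b = (u+v)/2, c = (u-v)/2 satisfy b² = a² + 1 and c² = a² -
3. Adding the point to its conjugate gives a rational solution of the same equations, which Fermat
descent excludes (`concordant_one_neg_three`). The sum formula degenerates only if a, b, c are each
rational or a rational multiple of √3. Then that descent, the one for the twist by 3
(`concordant_three_neg_nine`) and an obstruction modulo 3 leave only c = 0, that is u = v = 2. -/

/-! ### Coprime factors of squares and an obstruction modulo 3 -/

theorem Int.exists_sq_of_isCoprime_mul_eq_sq {a b c : ℤ} (h : IsCoprime a b) (hc : c ≠ 0)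
    (heq : a * b = c ^ 2) :
    ∃ x y : ℤ, (a = x ^ 2 ∧ b = y ^ 2) ∨ (a = -x ^ 2 ∧ b = -y ^ 2) := by
  obtain ⟨x, hx⟩ := Int.sq_of_isCoprime h heq
  obtain ⟨y, hy⟩ := Int.sq_of_isCoprime h.symm (by rw [mul_comm]; exact heq)
  have hpos : 0 < a * b := by rw [heq]; positivity
  refine ⟨x, y, ?_⟩
  rcases hx with hx | hx <;> rcases hy with hy | hy
  · exact Or.inl ⟨hx, hy⟩
  · exfalso; subst hx hy; nlinarith [mul_nonneg (sq_nonneg x) (sq_nonneg y)]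
  · exfalso; subst hx hy; nlinarith [mul_nonneg (sq_nonneg x) (sq_nonneg y)]
  · exact Or.inr ⟨hx, hy⟩

theorem Int.exists_sq_of_isCoprime_mul_eq_sq_of_pos {a b c : ℤ} (h : IsCoprime a b) (ha : 0 < a)
    (hc : c ≠ 0) (heq : a * b = c ^ 2) : ∃ x y : ℤ, a = x ^ 2 ∧ b = y ^ 2 := by
  obtain ⟨x, y, h | h⟩ := Int.exists_sq_of_isCoprime_mul_eq_sq h hc heq
  · exact ⟨x, y, h⟩
  · nlinarith [sq_nonneg x]

theorem Int.three_dvd_of_three_dvd_sq_add_sq {x y : ℤ} (h : 3 ∣ x ^ 2 + y ^ 2) :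
    3 ∣ x ∧ 3 ∣ y := by
  have hx : x % 3 = 0 ∨ x % 3 = 1 ∨ x % 3 = 2 := by omega
  have hy : y % 3 = 0 ∨ y % 3 = 1 ∨ y % 3 = 2 := by omega
  have h' := Int.emod_eq_zero_of_dvd h
  rcases hx with hx | hx | hx <;> rcases hy with hy | hy | hy <;>
    (simp [pow_two, Int.add_emod, Int.mul_emod, hx, hy] at h'; try omega)

/-- `x² + y² = 3z²` has only the trivial integral solution. -/
theorem Int.eq_zero_of_sq_add_sq_eq_three_mul_sq (n : ℕ) :
    ∀ x y z : ℤ, z.natAbs = n → x ^ 2 + y ^ 2 = 3 * z ^ 2 → z = 0 := by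
  induction n using Nat.strong_induction_on with
  | _ n ih =>
    intro x y z hn h
    by_contra hz
    obtain ⟨⟨a, rfl⟩, ⟨b, rfl⟩⟩ := Int.three_dvd_of_three_dvd_sq_add_sq ⟨z ^ 2, h⟩
    have h3 : (3 : ℤ) ∣ z ^ 2 := ⟨a ^ 2 + b ^ 2, by linarith⟩
    obtain ⟨c, rfl⟩ := Int.prime_three.dvd_of_dvd_pow h3
    have := ih c.natAbs (by omega) a b c rfl (by linarith)
    omega

theorem Rat.one_add_sq_ne_three_mul_sq (x y : ℚ) : 1 + x ^ 2 ≠ 3 * y ^ 2 := by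
  intro h
  have hx : (x.den : ℚ) ≠ 0 := by exact_mod_cast x.den_ne_zero
  have hy : (y.den : ℚ) ≠ 0 := by exact_mod_cast y.den_ne_zero
  rw [← Rat.num_div_den x, ← Rat.num_div_den y] at h
  field_simp at h
  have h' : ((x.den * y.den : ℤ)) ^ 2 + (x.num * y.den) ^ 2 = 3 * (y.num * x.den) ^ 2 := by
    have : (((x.den * y.den : ℤ)) ^ 2 + (x.num * y.den) ^ 2 : ℚ) = 3 * (y.num * x.den) ^ 2 := by
      push_cast; linarith
    exact_mod_cast this
  have h0 := Int.eq_zero_of_sq_add_sq_eq_three_mul_sq _ _ _ _ rfl h'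
  rw [h0] at h'
  have : (x.den * y.den : ℤ) ≠ 0 := by exact_mod_cast mul_ne_zero x.den_ne_zero y.den_ne_zero
  have := pow_pos (abs_pos.mpr this) 2
  rw [sq_abs] at this
  nlinarith [sq_nonneg (x.num * y.den : ℤ)]

/-! ### Framework for descent on concordant forms -/

/-- Two simultaneous equations `p² + c q² = s²`, `p² + d q² = r²` have only solutions with `q = 0`
if every coprime solution with `q ≠ 0` yields one with smaller nonzero `q`. -/
theorem concordant_descent (c d : ℤ)
    (step : ∀ p q r s : ℤ, IsCoprime p q → q ≠ 0 → p ^ 2 + c * q ^ 2 = s ^ 2 →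
      p ^ 2 + d * q ^ 2 = r ^ 2 → ∃ p' q' r' s' : ℤ, q' ≠ 0 ∧ q'.natAbs < q.natAbs ∧
        p' ^ 2 + c * q' ^ 2 = s' ^ 2 ∧ p' ^ 2 + d * q' ^ 2 = r' ^ 2) :
    ∀ p q r s : ℤ, p ^ 2 + c * q ^ 2 = s ^ 2 → p ^ 2 + d * q ^ 2 = r ^ 2 → q = 0 := by
  have key : ∀ n : ℕ, ∀ p q r s : ℤ, q.natAbs = n → p ^ 2 + c * q ^ 2 = s ^ 2 →
      p ^ 2 + d * q ^ 2 = r ^ 2 → q = 0 := by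
    intro n
    induction n using Nat.strong_induction_on with
    | _ n ih =>
      intro p q r s hn hs hr
      by_contra hq
      have hg : 0 < Int.gcd p q := Int.gcd_pos_of_ne_zero_right p hq
      obtain ⟨p', q', hco, hp', hq'⟩ := Int.exists_gcd_one hg
      set g : ℤ := (Int.gcd p q : ℤ) with hgdef
      have hg0 : g ≠ 0 := by positivity
      have hgs : g ^ 2 ∣ s ^ 2 := ⟨p' ^ 2 + c * q' ^ 2, by rw [← hs, hp', hq']; ring⟩
      have hgr : g ^ 2 ∣ r ^ 2 := ⟨p' ^ 2 + d * q' ^ 2, by rw [← hr, hp', hq']; ring⟩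
      rw [Int.pow_dvd_pow_iff two_ne_zero] at hgs hgr
      obtain ⟨s', rfl⟩ := hgs
      obtain ⟨r', rfl⟩ := hgr
      have hq'0 : q' ≠ 0 := by rintro rfl; simp at hq'; exact hq hq'
      have hs' : p' ^ 2 + c * q' ^ 2 = s' ^ 2 := by
        apply mul_left_cancel₀ (pow_ne_zero 2 hg0)
        rw [hp', hq'] at hs; linarith
      have hr' : p' ^ 2 + d * q' ^ 2 = r' ^ 2 := by
        apply mul_left_cancel₀ (pow_ne_zero 2 hg0)
        rw [hp', hq'] at hr; linarith
      obtain ⟨p₁, q₁, r₁, s₁, h0, hlt, h1, h2⟩ :=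
        step p' q' r' s' (Int.isCoprime_iff_gcd_eq_one.mpr hco) hq'0 hs' hr'
      have hle : q'.natAbs ≤ q.natAbs := by
        rw [hq', Int.natAbs_mul]
        exact Nat.le_mul_of_pos_right _ (Int.natAbs_pos.mpr hg0)
      exact h0 (ih _ (by omega) p₁ q₁ r₁ s₁ rfl h1 h2)
  exact fun p q r s => key _ p q r s rfl

theorem Rat.concordant_of_int {c d : ℤ}
    (h : ∀ p q r s : ℤ, p ^ 2 + c * q ^ 2 = s ^ 2 → p ^ 2 + d * q ^ 2 = r ^ 2 → q = 0)
    (x y z : ℚ) (hy : y ^ 2 = x ^ 2 + c) (hz : z ^ 2 = x ^ 2 + d) : False := by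
  have hx0 : (x.den : ℚ) ≠ 0 := by exact_mod_cast x.den_ne_zero
  have hy0 : (y.den : ℚ) ≠ 0 := by exact_mod_cast y.den_ne_zero
  have hz0 : (z.den : ℚ) ≠ 0 := by exact_mod_cast z.den_ne_zero
  have hx1 : x * x.den = x.num := Rat.mul_den_eq_num x
  have hy1 : y * y.den = y.num := Rat.mul_den_eq_num y
  have hz1 : z * z.den = z.num := Rat.mul_den_eq_num z
  have := h (x.num * y.den * z.den) (x.den * y.den * z.den) (x.den * y.den * z.num)
    (x.den * y.num * z.den)
    (by
      have : ((x.num * y.den * z.den) ^ 2 + c * (x.den * y.den * z.den) ^ 2 : ℚ) =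
          (x.den * y.num * z.den) ^ 2 := by
        rw [← hx1, ← hy1]; linear_combination (-(x.den * y.den * z.den : ℚ) ^ 2) * hy
      exact_mod_cast this)
    (by
      have : ((x.num * y.den * z.den) ^ 2 + d * (x.den * y.den * z.den) ^ 2 : ℚ) =
          (x.den * y.den * z.num) ^ 2 := by
        rw [← hx1, ← hz1]; linear_combination (-(x.den * y.den * z.den : ℚ) ^ 2) * hz
      exact_mod_cast this)
  have h' : (x.den * y.den * z.den : ℤ) ≠ 0 := by
    exact_mod_cast mul_ne_zero (mul_ne_zero x.den_ne_zero y.den_ne_zero) z.den_ne_zero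
  exact h' this

theorem Int.sq_emod_sixteen (x : ℤ) :
    (x % 2 = 0 ∧ (x ^ 2 % 16 = 0 ∨ x ^ 2 % 16 = 4)) ∨
      (x % 2 = 1 ∧ (x ^ 2 % 16 = 1 ∨ x ^ 2 % 16 = 9)) := by
  have h : x % 16 = 0 ∨ x % 16 = 1 ∨ x % 16 = 2 ∨ x % 16 = 3 ∨ x % 16 = 4 ∨ x % 16 = 5 ∨
      x % 16 = 6 ∨ x % 16 = 7 ∨ x % 16 = 8 ∨ x % 16 = 9 ∨ x % 16 = 10 ∨ x % 16 = 11 ∨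
      x % 16 = 12 ∨ x % 16 = 13 ∨ x % 16 = 14 ∨ x % 16 = 15 := by omega
  rcases h with h | h | h | h | h | h | h | h | h | h | h | h | h | h | h | h <;>
    simp [pow_two, Int.mul_emod, h] <;> omega

theorem Int.isCoprime_of_forall_prime {x y : ℤ} (h0 : x ≠ 0)
    (h : ∀ l : ℤ, Prime l → l ∣ x → l ∣ y → False) : IsCoprime x y :=
  isCoprime_of_prime_dvd (fun h' => h0 h'.1) fun l hl h1 h2 => h l hl h1 h2

theorem IsCoprime.false_of_prime_dvd {x y l : ℤ} (h : IsCoprime x y) (hl : Prime l)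
    (hx : l ∣ x) (hy : l ∣ y) : False :=
  hl.not_isUnit (h.isUnit_of_dvd' hx hy)

/-- If `β² x = γ² y` with `β, γ` coprime, then `x = g γ²` and `y = g β²`. -/
theorem IsCoprime.exists_eq_mul_sq_of_sq_mul_eq {b c x y : ℤ} (h : IsCoprime b c) (hc : c ≠ 0)
    (he : b ^ 2 * x = c ^ 2 * y) : ∃ g, x = g * c ^ 2 ∧ y = g * b ^ 2 := by
  have : c ^ 2 ∣ x := (h.symm.pow (m := 2) (n := 2)).dvd_of_dvd_mul_left ⟨y, he⟩
  obtain ⟨g, rfl⟩ := this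
  refine ⟨g, mul_comm _ _, ?_⟩
  apply mul_left_cancel₀ (pow_ne_zero 2 hc)
  rw [← he]; ring

/-! ### Descent for p² + q² and p² - 3q² -/

/-- With A = 2a the quartic factors as (A² + Ab + b²)(A² - Ab + b²), whose coprime positive factors
are squares (m+n)² and (m-n)². This gives mn = ab and m² + n² = A² + b², and a common factorization
of mn and ab yields the smaller solution. -/
theorem quartic_descent_even {a b c : ℤ} (hab : IsCoprime (2 * a) b) (ha : a ≠ 0) (hb : b ≠ 0)
    (h : c ^ 2 = (2 * a) ^ 4 + (2 * a) ^ 2 * b ^ 2 + b ^ 4) :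
    ∃ p q r s : ℤ, q ≠ 0 ∧ q.natAbs < (2 * a * b).natAbs ∧
      p ^ 2 + 1 * q ^ 2 = s ^ 2 ∧ p ^ 2 + (-3) * q ^ 2 = r ^ 2 := by
  have hbodd : b % 2 = 1 := by
    by_contra hb2
    exact hab.false_of_prime_dvd Int.prime_two ⟨a, rfl⟩ (by omega)
  have hc : c ≠ 0 := by
    rintro rfl
    have : 0 < b ^ 4 := by positivity
    nlinarith [sq_nonneg ((2 * a) ^ 2), sq_nonneg (2 * a * b)]
  have hpos : 0 < (2 * a) ^ 2 + 2 * a * b + b ^ 2 := by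
    have : 0 < b ^ 2 := by positivity
    nlinarith [sq_nonneg (2 * (2 * a) + b)]
  have hco : IsCoprime ((2 * a) ^ 2 + 2 * a * b + b ^ 2) ((2 * a) ^ 2 - 2 * a * b + b ^ 2) := by
    refine Int.isCoprime_of_forall_prime hpos.ne' fun l hl h1 h2 => ?_
    have h4 : l ∣ (2 * a * b) * 2 := by
      have := dvd_sub h1 h2
      ring_nf at this ⊢
      exact this
    have h5 : l ∣ ((2 * a) ^ 2 + b ^ 2) * 2 := by
      have := dvd_add h1 h2
      ring_nf at this ⊢
      exact this
    have hl2 : ¬ l ∣ 2 := by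
      intro hl2
      have h6 : l ∣ b ^ 2 := by
        have := dvd_sub h1 (hl2.mul_right (2 * a ^ 2 + a * b))
        ring_nf at this
        exact this
      exact hab.false_of_prime_dvd hl (hl2.mul_right a) (hl.dvd_of_dvd_pow h6)
    have h4' := (hl.dvd_or_dvd h4).resolve_right hl2
    have h5' := (hl.dvd_or_dvd h5).resolve_right hl2
    rcases hl.dvd_or_dvd h4' with h6 | h6
    · exact hab.false_of_prime_dvd hl h6
        (hl.dvd_of_dvd_pow ((dvd_add_right (h6.pow two_ne_zero)).1 h5'))
    · exact hab.false_of_prime_dvd hl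
        (hl.dvd_of_dvd_pow ((dvd_add_left (h6.pow two_ne_zero)).1 h5')) h6
  obtain ⟨S, R, hS, hR⟩ := Int.exists_sq_of_isCoprime_mul_eq_sq_of_pos hco hpos hc
    (by rw [h]; ring)
  have hpar : ∃ m n, S = m + n ∧ R = m - n := by
    refine ⟨(S + R) / 2, (S - R) / 2, ?_⟩
    have : S ^ 2 - R ^ 2 = 4 * (a * b) := by rw [← hS, ← hR]; ring
    rcases Int.sq_emod_sixteen S with h1 | h1 <;> rcases Int.sq_emod_sixteen R with h2 | h2 <;> omega
  obtain ⟨m, n, rfl, rfl⟩ := hpar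
  have hmn : m * n = a * b := by linarith
  have hsum : m ^ 2 + n ^ 2 = (2 * a) ^ 2 + b ^ 2 := by linarith
  -- Four-number lemma: m = αβ, n = γδ, a = αγ, b = βδ.
  obtain ⟨α, γ, ⟨β, rfl⟩, ⟨δ, rfl⟩, rfl⟩ := exists_dvd_and_dvd_of_dvd_mul (⟨b, hmn⟩ : a ∣ m * n)
  have hb' : b = β * δ := by
    apply mul_left_cancel₀ ha
    rw [← hmn]; ring
  subst hb'
  have hα := left_ne_zero_of_mul ha
  have hγ := right_ne_zero_of_mul ha
  have hβ := left_ne_zero_of_mul hb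
  have hδ := right_ne_zero_of_mul hb
  have hβγ : IsCoprime β γ :=
    (hab.of_isCoprime_of_dvd_left ⟨2 * α, by ring⟩).symm.of_isCoprime_of_dvd_left ⟨δ, by ring⟩
  have hαδ : IsCoprime α δ :=
    (hab.of_isCoprime_of_dvd_left ⟨2 * γ, by ring⟩).of_isCoprime_of_dvd_right ⟨β, by ring⟩
  obtain ⟨g, hg1, hg2⟩ := hβγ.exists_eq_mul_sq_of_sq_mul_eq hγ
    (show β ^ 2 * (α ^ 2 - δ ^ 2) = γ ^ 2 * (4 * α ^ 2 - δ ^ 2) by linear_combination hsum)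
  have hβo : β % 2 = 1 ∧ δ % 2 = 1 := by
    have := Int.mul_emod β δ 2
    rw [hbodd] at this
    rcases Int.emod_two_eq_zero_or_one β with h1 | h1 <;>
      rcases Int.emod_two_eq_zero_or_one δ with h2 | h2 <;> rw [h1, h2] at this <;> omega
  have hg3 : g ∣ 3 := by
    have h1 : g ∣ α ^ 2 * 3 := ⟨β ^ 2 - γ ^ 2, by linear_combination hg2 - hg1⟩
    have h2 : g ∣ δ ^ 2 * 3 := ⟨β ^ 2 - 4 * γ ^ 2, by linear_combination hg2 - 4 * hg1⟩
    obtain ⟨x, y, hxy⟩ := hαδ.pow (m := 2) (n := 2)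
    have := dvd_add (h1.mul_left x) (h2.mul_left y)
    rwa [← mul_assoc, ← mul_assoc, ← add_mul, hxy, one_mul] at this
  have hgcases : g = 1 ∨ g = -1 ∨ g = 3 ∨ g = -3 := by
    have h1 := Int.le_of_dvd (by norm_num) hg3
    have h2 := Int.le_of_dvd (by norm_num) (neg_dvd.mpr hg3)
    have : g = -3 ∨ g = -2 ∨ g = -1 ∨ g = 0 ∨ g = 1 ∨ g = 2 ∨ g = 3 := by omega
    rcases this with rfl | rfl | rfl | rfl | rfl | rfl | rfl <;> simp at hg3 ⊢
  have hsqβ := Int.sq_emod_sixteen β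
  have hsqδ := Int.sq_emod_sixteen δ
  have hlt : ∀ x y : ℤ, x ≠ 0 → y ≠ 0 → x.natAbs < (2 * (x * y)).natAbs := by
    intro x y hx hy
    rw [Int.natAbs_mul, Int.natAbs_mul]
    have h1 := Int.natAbs_pos.mpr hx
    have h2 := Int.natAbs_pos.mpr hy
    have := Nat.le_mul_of_pos_right x.natAbs h2
    simp only [Int.reduceAbs]
    omega
  -- Since β and δ are odd, g = 1 and g = -3 fail modulo 4. For g = -1 and g = 3 the two equations
  -- for g are linear combinations of the required ones.
  rcases hgcases with rfl | rfl | rfl | rfl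
  · omega
  · refine ⟨γ, α, β, δ, hα, ?_, by linarith, by linarith⟩
    have := hlt α (γ * (β * δ)) hα (mul_ne_zero hγ hb)
    convert this using 2; ring
  · refine ⟨α, γ, δ, β, hγ, ?_, by linarith, by linarith⟩
    have := hlt γ (α * (β * δ)) hγ (mul_ne_zero hα hb)
    convert this using 2; ring
  · omega

theorem quartic_descent {a b c : ℤ} (hab : IsCoprime a b) (ha : a ≠ 0) (hb : b ≠ 0)
    (h : c ^ 2 = a ^ 4 + a ^ 2 * b ^ 2 + b ^ 4) :
    ∃ p q r s : ℤ, q ≠ 0 ∧ q.natAbs < (a * b).natAbs ∧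
      p ^ 2 + 1 * q ^ 2 = s ^ 2 ∧ p ^ 2 + (-3) * q ^ 2 = r ^ 2 := by
  rcases Int.emod_two_eq_zero_or_one a with ha2 | ha2
  · obtain ⟨a, rfl⟩ := Int.dvd_of_emod_eq_zero ha2
    exact quartic_descent_even hab (right_ne_zero_of_mul ha) hb h
  rcases Int.emod_two_eq_zero_or_one b with hb2 | hb2
  · obtain ⟨b, rfl⟩ := Int.dvd_of_emod_eq_zero hb2
    rw [mul_comm a]
    exact quartic_descent_even hab.symm (right_ne_zero_of_mul hb) ha (by rw [h]; ring)
  · exfalso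
    obtain ⟨x, rfl⟩ : ∃ x, a = 2 * x + 1 := ⟨a / 2, by omega⟩
    obtain ⟨y, rfl⟩ : ∃ y, b = 2 * y + 1 := ⟨b / 2, by omega⟩
    have h1 := Int.sq_emod_sixteen c
    -- For a and b odd, c² would be 3 modulo 4.
    have : c ^ 2 = 4 * ((x ^ 2 + x) * (4 * (x ^ 2 + x) + 2) + (y ^ 2 + y) * (4 * (y ^ 2 + y) + 2)
        + (4 * (x ^ 2 + x) * (y ^ 2 + y) + x ^ 2 + x + y ^ 2 + y)) + 3 := by rw [h]; ring
    omega

/-- Writing s = m + n, r = m - n gives mn = q² and p² = m² + mn + n². Coprimality makes m, n squares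
up to a common sign, so p² = a⁴ + a²b² + b⁴ with |q| = |ab|, and `quartic_descent` applies. -/
theorem concordant_one_neg_three : ∀ p q r s : ℤ, p ^ 2 + 1 * q ^ 2 = s ^ 2 →
    p ^ 2 + (-3) * q ^ 2 = r ^ 2 → q = 0 := by
  apply concordant_descent
  intro p q r s hco hq hs hr
  obtain ⟨m, n, rfl, rfl⟩ : ∃ m n, s = m + n ∧ r = m - n := by
    refine ⟨(s + r) / 2, (s - r) / 2, ?_⟩
    rcases Int.sq_emod_sixteen s with h1 | h1 <;> rcases Int.sq_emod_sixteen r with h2 | h2 <;> omega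
  have hmn : m * n = q ^ 2 := by linarith
  have hp : p ^ 2 = m ^ 2 + m * n + n ^ 2 := by linarith
  have hmn_co : IsCoprime m n := by
    refine Int.isCoprime_of_forall_prime ?_ fun l hl h1 h2 => ?_
    · rintro rfl
      rw [zero_mul] at hmn
      exact hq (pow_eq_zero_iff two_ne_zero |>.1 hmn.symm)
    · refine hco.false_of_prime_dvd hl (hl.dvd_of_dvd_pow (n := 2) ?_)
        (hl.dvd_of_dvd_pow (n := 2) ?_)
      · rw [hp]
        exact dvd_add (dvd_add (h1.pow two_ne_zero) (h1.mul_right n)) (h2.pow two_ne_zero)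
      · rw [← hmn]; exact h1.mul_right n
  obtain ⟨a, b, h⟩ := Int.exists_sq_of_isCoprime_mul_eq_sq hmn_co hq hmn
  have hab : IsCoprime (a ^ 2) (b ^ 2) ∧ q ^ 2 = (a * b) ^ 2 ∧
      p ^ 2 = a ^ 4 + a ^ 2 * b ^ 2 + b ^ 4 := by
    rcases h with ⟨rfl, rfl⟩ | ⟨rfl, rfl⟩
    · exact ⟨hmn_co, by linarith, by linarith⟩
    · exact ⟨(IsCoprime.neg_neg_iff _ _).1 hmn_co, by linarith, by linarith⟩
  obtain ⟨h1, h2, h3⟩ := hab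
  have hab0 : a * b ≠ 0 := by
    intro h0; rw [h0] at h2; exact hq (by simpa using h2)
  rw [Int.natAbs_eq_iff_sq_eq.mpr h2]
  exact quartic_descent ((IsCoprime.pow_iff two_pos two_pos).1 h1) (left_ne_zero_of_mul hab0)
    (right_ne_zero_of_mul hab0) h3

/-! ### Descent for p² + 3q² and p² - 9q² -/

theorem Int.eq_three_mul_sq_of_mul_eq {a b c : ℤ} (h : IsCoprime a b) (hc : c ≠ 0)
    (h3 : 3 ∣ a) (heq : a * b = 3 * c ^ 2) :
    ∃ x y : ℤ, (a = 3 * x ^ 2 ∧ b = y ^ 2) ∨ (a = -(3 * x ^ 2) ∧ b = -y ^ 2) := by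
  obtain ⟨a, rfl⟩ := h3
  obtain ⟨x, y, hxy⟩ := Int.exists_sq_of_isCoprime_mul_eq_sq (h.of_isCoprime_of_dvd_left ⟨3, by ring⟩)
    hc (show a * b = c ^ 2 by linarith)
  refine ⟨x, y, ?_⟩
  rcases hxy with ⟨rfl, rfl⟩ | ⟨rfl, rfl⟩
  · exact Or.inl ⟨rfl, rfl⟩
  · exact Or.inr ⟨by ring, rfl⟩

theorem Int.three_dvd_of_sq_dvd {x : ℤ} (h : 3 ∣ x ^ 2) : 3 ∣ x :=
  Int.prime_three.dvd_of_dvd_pow h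

theorem Int.three_dvd_of_prime_dvd {l : ℤ} (hl : Prime l) (h : l ∣ 3) : 3 ∣ l :=
  ((hl.dvd_prime_iff_associated Int.prime_three).1 h).symm.dvd

/-- Coprime factors of a nonzero square are both negatives of squares when one of them is
congruent to `-b²` modulo `3` with `3 ∤ b`. -/
theorem Int.neg_sq_of_three_dvd_add_sq {u v n b : ℤ} (huv : IsCoprime u v) (hn : n ≠ 0)
    (h : u * v = n ^ 2) (hb : ¬ 3 ∣ b) (h3 : 3 ∣ u + b ^ 2) :
    ∃ x y : ℤ, u = -x ^ 2 ∧ v = -y ^ 2 := by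
  obtain ⟨x, y, ⟨rfl, -⟩ | hxy⟩ := Int.exists_sq_of_isCoprime_mul_eq_sq huv hn h
  · exact absurd (Int.three_dvd_of_three_dvd_sq_add_sq h3).2 hb
  · exact ⟨x, y, hxy⟩

/-- The factors are coprime and congruent to -b² modulo 3, so both are negatives of squares; their
difference 9a² gives the second equation. -/
theorem descent_of_six_sq {a b n : ℤ} (hab : IsCoprime a b) (hn : n ≠ 0)
    (h3 : ¬ 3 ∣ b) (h : n ^ 2 = (3 * a ^ 2 - b ^ 2) * (12 * a ^ 2 - b ^ 2)) :
    ∃ x y : ℤ, x ^ 2 + 3 * a ^ 2 = b ^ 2 ∧ x ^ 2 + (-9) * a ^ 2 = y ^ 2 := by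
  have hco : IsCoprime (3 * a ^ 2 - b ^ 2) (12 * a ^ 2 - b ^ 2) := by
    refine Int.isCoprime_of_forall_prime ?_ fun l hl h1 h2 => ?_
    · intro h0; rw [h0, zero_mul] at h; exact hn (by simpa using h)
    have hl3 : ¬ l ∣ 3 := fun hl3 => h3 (by
      have := hl.dvd_of_dvd_pow (n := 2) ((dvd_sub_right (hl3.mul_right (a ^ 2))).1 h1)
      exact (Int.three_dvd_of_prime_dvd hl hl3).trans this)
    have h4 : l ∣ 3 * (3 * a ^ 2) := by
      have := dvd_sub h2 h1; ring_nf at this ⊢; exact this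
    have h5 := (hl.dvd_or_dvd ((hl.dvd_or_dvd h4).resolve_left hl3)).resolve_left hl3
    have h6 := hl.dvd_of_dvd_pow (n := 2) ((dvd_sub_right (h5.mul_left 3)).1 h1)
    exact hab.false_of_prime_dvd hl (hl.dvd_of_dvd_pow h5) h6
  obtain ⟨x, y, hx, hy⟩ := Int.neg_sq_of_three_dvd_add_sq hco hn h.symm h3 ⟨a ^ 2, by ring⟩
  exact ⟨x, y, by linarith, by linarith⟩

/-- As in `descent_of_six_sq` both factors are negatives of squares, but b² - 3a² and 4b² - 3a²
cannot both be squares modulo 16 for odd a. -/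
theorem false_of_two_sq_three_sq {a b n : ℤ} (hab : IsCoprime a b) (hn : n ≠ 0) (ha : a % 2 = 1)
    (h3 : ¬ 3 ∣ b) (h : n ^ 2 = (3 * a ^ 2 - 4 * b ^ 2) * (3 * a ^ 2 - b ^ 2)) : False := by
  have hco : IsCoprime (3 * a ^ 2 - b ^ 2) (3 * a ^ 2 - 4 * b ^ 2) := by
    refine Int.isCoprime_of_forall_prime ?_ fun l hl h1 h2 => ?_
    · intro h0; rw [h0, mul_zero] at h; exact hn (by simpa using h)
    have hl3 : ¬ l ∣ 3 := fun hl3 => h3 (by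
      have := hl.dvd_of_dvd_pow (n := 2) ((dvd_sub_right (hl3.mul_right (a ^ 2))).1 h1)
      exact (Int.three_dvd_of_prime_dvd hl hl3).trans this)
    have h4 : l ∣ 3 * b ^ 2 := by
      have := dvd_sub h1 h2; ring_nf at this ⊢; exact this
    have h5 := (hl.dvd_or_dvd h4).resolve_left hl3
    have h6 := (hl.dvd_or_dvd ((dvd_sub_left h5).1 h1)).resolve_left hl3
    exact hab.false_of_prime_dvd hl (hl.dvd_of_dvd_pow h6) (hl.dvd_of_dvd_pow h5)
  obtain ⟨x, y, hx, hy⟩ := Int.neg_sq_of_three_dvd_add_sq hco hn (by rw [h, mul_comm]) h3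
    ⟨a ^ 2, by ring⟩
  have h1 := Int.sq_emod_sixteen a
  have h2 := Int.sq_emod_sixteen b
  have h4 := Int.sq_emod_sixteen x
  have h5 := Int.sq_emod_sixteen y
  omega

theorem descent_of_mul_eq_six_sq_aux {μ ν k n : ℤ} (hμν : IsCoprime (2 * μ) ν) (hk : k ≠ 0)
    (hn : n ≠ 0) (hm : μ * ν = 3 * k ^ 2)
    (h : n ^ 2 = (μ - ν) * (4 * μ - ν)) :
    ∃ p q r s : ℤ, q ≠ 0 ∧ q.natAbs ≤ k.natAbs ∧
      p ^ 2 + 3 * q ^ 2 = s ^ 2 ∧ p ^ 2 + (-9) * q ^ 2 = r ^ 2 := by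
  have hco : IsCoprime μ ν := hμν.of_isCoprime_of_dvd_left ⟨2, by ring⟩
  have hν2 : ν % 2 = 1 := by
    by_contra h2
    exact hμν.false_of_prime_dvd Int.prime_two ⟨μ, rfl⟩ (by omega)
  rcases Int.prime_three.dvd_or_dvd ⟨k ^ 2, hm⟩ with h3μ | h3ν
  · obtain ⟨a, b, hab⟩ := Int.eq_three_mul_sq_of_mul_eq hco hk h3μ hm
    have h' : k ^ 2 = (a * b) ^ 2 ∧ IsCoprime (3 * a ^ 2) (b ^ 2) ∧
        n ^ 2 = (3 * a ^ 2 - b ^ 2) * (12 * a ^ 2 - b ^ 2) := by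
      rcases hab with ⟨rfl, rfl⟩ | ⟨rfl, rfl⟩
      · exact ⟨by linarith, hco, by linarith⟩
      · exact ⟨by linarith, (IsCoprime.neg_neg_iff _ _).1 hco, by linarith⟩
    obtain ⟨hk2, hco', hn2⟩ := h'
    have hab' : IsCoprime a b := (IsCoprime.pow_iff two_pos two_pos).1
      (hco'.of_isCoprime_of_dvd_left ⟨3, by ring⟩)
    have h3b : ¬ 3 ∣ b := fun hb =>
      hco'.false_of_prime_dvd Int.prime_three ⟨a ^ 2, rfl⟩ (hb.pow two_ne_zero)
    obtain ⟨x, y, hx, hy⟩ := descent_of_six_sq hab' hn h3b hn2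
    have hab0 : a * b ≠ 0 := by
      intro h0; rw [h0] at hk2; exact hk (by simpa using hk2)
    refine ⟨x, a, y, b, left_ne_zero_of_mul hab0, ?_, hx, hy⟩
    rw [Int.natAbs_eq_iff_sq_eq.mpr hk2, Int.natAbs_mul]
    exact Nat.le_mul_of_pos_right _ (Int.natAbs_pos.mpr (right_ne_zero_of_mul hab0))
  · exfalso
    obtain ⟨a, b, hab⟩ := Int.eq_three_mul_sq_of_mul_eq hco.symm hk h3ν (by rw [mul_comm, hm])
    have h' : IsCoprime (3 * a ^ 2) (b ^ 2) ∧ (3 * a ^ 2) % 2 = 1 ∧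
        n ^ 2 = (3 * a ^ 2 - 4 * b ^ 2) * (3 * a ^ 2 - b ^ 2) := by
      rcases hab with ⟨rfl, rfl⟩ | ⟨rfl, rfl⟩
      · exact ⟨hco.symm, hν2, by linarith⟩
      · exact ⟨(IsCoprime.neg_neg_iff _ _).1 hco.symm, by omega, by linarith⟩
    obtain ⟨hco', ha2, hn2⟩ := h'
    have hab' : IsCoprime a b := (IsCoprime.pow_iff two_pos two_pos).1
      (hco'.of_isCoprime_of_dvd_left ⟨3, by ring⟩)
    have h3b : ¬ 3 ∣ b := fun hb =>
      hco'.false_of_prime_dvd Int.prime_three ⟨a ^ 2, rfl⟩ (hb.pow two_ne_zero)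
    have ha := Int.sq_emod_sixteen a
    exact false_of_two_sq_three_sq hab' hn (by omega) h3b hn2

theorem descent_of_mul_eq_six_sq {μ ν k n : ℤ} (hμν : IsCoprime μ ν) (hk : k ≠ 0)
    (hn : n ≠ 0) (hm : μ * ν = 6 * k ^ 2)
    (h : 2 * n ^ 2 = (μ - 2 * ν) * (2 * μ - ν)) :
    ∃ p q r s : ℤ, q ≠ 0 ∧ q.natAbs ≤ k.natAbs ∧
      p ^ 2 + 3 * q ^ 2 = s ^ 2 ∧ p ^ 2 + (-9) * q ^ 2 = r ^ 2 := by
  rcases Int.prime_two.dvd_or_dvd (⟨3 * k ^ 2, by linarith⟩ : (2 : ℤ) ∣ μ * ν) with ⟨μ, rfl⟩ | ⟨ν, rfl⟩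
  · exact descent_of_mul_eq_six_sq_aux hμν hk hn (by linarith) (by linarith)
  · exact descent_of_mul_eq_six_sq_aux hμν.symm hk hn (by linarith) (by linarith)

/-- The factors are coprime, hence squares (μ-ν)² and (μ+ν)²; their difference 24k² gives μν = 6k².
The splitting of the primes 2 and 3 between μ and ν is then decided in `descent_of_mul_eq_six_sq`.
-/
theorem descent_of_product_of_forms {k n s : ℤ} (hkn : IsCoprime k n) (h3 : ¬ 3 ∣ n)
    (hpar : k % 2 = 0 ∧ n % 2 = 1 ∨ k % 2 = 1 ∧ n % 2 = 0) (hk : k ≠ 0)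
    (h : s ^ 2 = (n ^ 2 + 3 * k ^ 2) * (n ^ 2 + 27 * k ^ 2)) :
    ∃ p q r s : ℤ, q ≠ 0 ∧ q.natAbs ≤ k.natAbs ∧
      p ^ 2 + 3 * q ^ 2 = s ^ 2 ∧ p ^ 2 + (-9) * q ^ 2 = r ^ 2 := by
  have hn : n ≠ 0 := by rintro rfl; exact h3 (dvd_zero 3)
  have hk2 : 0 < k ^ 2 := by positivity
  have hpos : 0 < n ^ 2 + 3 * k ^ 2 := by positivity
  have hs : s ≠ 0 := by
    rintro rfl
    have : 0 < (n ^ 2 + 3 * k ^ 2) * (n ^ 2 + 27 * k ^ 2) := by positivity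
    rw [← h] at this; simp at this
  have hsk := Int.sq_emod_sixteen k
  have hsn := Int.sq_emod_sixteen n
  have hco : IsCoprime (n ^ 2 + 3 * k ^ 2) (n ^ 2 + 27 * k ^ 2) := by
    refine Int.isCoprime_of_forall_prime hpos.ne' fun l hl h1 h2 => ?_
    have hl2 : ¬ l ∣ 2 := fun hl2 => by
      have := ((hl.dvd_prime_iff_associated Int.prime_two).1 hl2).symm.dvd.trans h1
      omega
    have hl3 : ¬ l ∣ 3 := fun hl3 => h3 (by
      have := hl.dvd_of_dvd_pow (n := 2) ((dvd_add_left (hl3.mul_right (k ^ 2))).1 h1)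
      exact (Int.three_dvd_of_prime_dvd hl hl3).trans this)
    have h4 : l ∣ 2 ^ 3 * n ^ 2 := by
      have := dvd_sub (h1.mul_left 9) h2; ring_nf at this ⊢; exact this
    have h5 := (hl.dvd_or_dvd h4).resolve_left fun h => hl2 (hl.dvd_of_dvd_pow h)
    have h6 := (hl.dvd_or_dvd ((dvd_add_right h5).1 h1)).resolve_left hl3
    exact hkn.false_of_prime_dvd hl (hl.dvd_of_dvd_pow h6) (hl.dvd_of_dvd_pow h5)
  obtain ⟨R, S, hR, hS⟩ := Int.exists_sq_of_isCoprime_mul_eq_sq_of_pos hco hpos hs h.symm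
  obtain ⟨μ, ν, rfl, rfl⟩ : ∃ μ ν, S = μ + ν ∧ R = μ - ν := by
    refine ⟨(S + R) / 2, (S - R) / 2, ?_⟩
    rcases Int.sq_emod_sixteen S with h1 | h1 <;> rcases Int.sq_emod_sixteen R with h2 | h2 <;> omega
  have hm : μ * ν = 6 * k ^ 2 := by linarith
  have hn2 : 2 * n ^ 2 = (μ - 2 * ν) * (2 * μ - ν) := by linarith
  refine descent_of_mul_eq_six_sq ?_ hk hn hm hn2
  have hco' : IsCoprime ((μ - ν) ^ 2) ((μ + ν) ^ 2) := by rw [← hR, ← hS]; exact hco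
  refine Int.isCoprime_of_forall_prime ?_ fun l hl h1 h2 => ?_
  · rintro rfl
    rw [zero_mul] at hm; linarith
  · exact hco'.false_of_prime_dvd hl ((dvd_sub h1 h2).pow two_ne_zero)
      ((dvd_add h1 h2).pow two_ne_zero)

/-- The second equation is a primitive Pythagorean triple (r, 3q, p). Its parameters are n and 3k up
to order, so q = 2kn, and the first equation becomes s² = (n² + 3k²)(n² + 27k²). The next solution
has its q bounded by |k| < |q|. -/
theorem concordant_three_neg_nine : ∀ p q r s : ℤ, p ^ 2 + 3 * q ^ 2 = s ^ 2 →
    p ^ 2 + (-9) * q ^ 2 = r ^ 2 → q = 0 := by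
  apply concordant_descent
  intro p q r s hco hq hs hr
  have hp3 : ¬ 3 ∣ p := by
    rintro ⟨p, rfl⟩
    obtain ⟨s, rfl⟩ := Int.three_dvd_of_sq_dvd
      (⟨3 * p ^ 2 + q ^ 2, by rw [← hs]; ring⟩ : 3 ∣ s ^ 2)
    exact hco.false_of_prime_dvd Int.prime_three ⟨p, rfl⟩
      (Int.three_dvd_of_sq_dvd ⟨s ^ 2 * 1 - p ^ 2, by linarith⟩)
  have hp0 : p ≠ 0 := by rintro rfl; exact hp3 (dvd_zero 3)
  have hsp := Int.sq_emod_sixteen p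
  have hsq := Int.sq_emod_sixteen q
  have hss := Int.sq_emod_sixteen s
  have hsr := Int.sq_emod_sixteen r
  have hq2 : q % 2 = 0 := by omega
  have hp2 : p % 2 = 1 := by
    by_contra h
    exact hco.false_of_prime_dvd Int.prime_two (by omega : (2 : ℤ) ∣ p) (by omega)
  have htriple : PythagoreanTriple r (3 * q) |p| := by
    unfold PythagoreanTriple
    rw [abs_mul_abs_self]; linarith
  have hgcd : IsCoprime r (3 * q) := by
    refine Int.isCoprime_of_forall_prime (by rintro rfl; omega) fun l hl h1 h2 => ?_
    have hlp : l ∣ p := by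
      apply hl.dvd_of_dvd_pow (n := 2)
      rw [show p ^ 2 = r ^ 2 + (3 * q) ^ 2 by linarith]
      exact dvd_add (h1.pow two_ne_zero) (h2.pow two_ne_zero)
    rcases hl.dvd_or_dvd h2 with h3 | h3
    · exact hp3 ((Int.three_dvd_of_prime_dvd hl h3).trans hlp)
    · exact hco.false_of_prime_dvd hl hlp h3
  obtain ⟨m, n, -, hqmn, hpmn, hmn, hpar, -⟩ := htriple.coprime_classification'
    (Int.isCoprime_iff_gcd_eq_one.1 hgcd) (by omega) (abs_pos.mpr hp0)
  have hmn := Int.isCoprime_iff_gcd_eq_one.2 hmn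
  have hp' : p ^ 2 = (m ^ 2 + n ^ 2) ^ 2 := by rw [← hpmn, sq_abs]
  have main : ∀ k n : ℤ, IsCoprime (3 * k) n →
      (k % 2 = 0 ∧ n % 2 = 1 ∨ k % 2 = 1 ∧ n % 2 = 0) → q = 2 * k * n →
      p ^ 2 = (9 * k ^ 2 + n ^ 2) ^ 2 → ∃ p' q' r' s' : ℤ, q' ≠ 0 ∧ q'.natAbs < q.natAbs ∧
        p' ^ 2 + 3 * q' ^ 2 = s' ^ 2 ∧ p' ^ 2 + (-9) * q' ^ 2 = r' ^ 2 := by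
    rintro k n hkn hpar rfl hp'
    have hk : k ≠ 0 := right_ne_zero_of_mul (left_ne_zero_of_mul hq)
    have hn : n ≠ 0 := right_ne_zero_of_mul hq
    have h3n : ¬ 3 ∣ n := hkn.false_of_prime_dvd Int.prime_three ⟨k, rfl⟩
    obtain ⟨p₁, q₁, r₁, s₁, h0, hle, h1, h2⟩ := descent_of_product_of_forms (s := s)
      (hkn.of_isCoprime_of_dvd_left ⟨3, by ring⟩) h3n hpar hk (by rw [← hs, hp']; ring)
    refine ⟨p₁, q₁, r₁, s₁, h0, ?_, h1, h2⟩
    rw [mul_assoc, Int.natAbs_mul, Int.natAbs_mul]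
    have := Nat.le_mul_of_pos_right k.natAbs (Int.natAbs_pos.mpr hn)
    have := Int.natAbs_pos.mpr hk
    simp only [Int.reduceAbs]
    omega
  have h3mn : (3 : ℤ) ∣ 2 * (m * n) := ⟨q, by linarith⟩
  rcases Int.prime_three.dvd_or_dvd
    ((Int.prime_three.dvd_or_dvd h3mn).resolve_left (by norm_num)) with ⟨k, rfl⟩ | ⟨k, rfl⟩
  · exact main k n hmn (by omega) (by linarith) (by rw [hp']; ring)
  · exact main k m hmn.symm (by omega) (by linarith) (by rw [hp']; ring)

/-! ### From ℚ(√3) to ℚ -/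

theorem mul_eq_zero_of_translates_eq_sq {p₁ q₁ p₂ q₂ p₃ q₃ : ℚ}
    (h2 : p₂ ^ 2 + 3 * q₂ ^ 2 = p₁ ^ 2 + 3 * q₁ ^ 2 + 1) (h2' : p₂ * q₂ = p₁ * q₁)
    (h3 : p₃ ^ 2 + 3 * q₃ ^ 2 = p₁ ^ 2 + 3 * q₁ ^ 2 - 3) (h3' : p₃ * q₃ = p₁ * q₁) :
    p₁ * q₁ = 0 := by
  by_contra hm
  have h4 : (2 * (p₁ * q₁)) ^ 2 ≠ 0 := pow_ne_zero 2 (mul_ne_zero two_ne_zero hm)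
  -- With a, b, c = pᵢ + qᵢ√3 and bars for conjugates, addition of the point and its conjugate on y²
  -- = x(x+1)(x-3) gives (a·b̄c̄ - ā·bc)/(a² - ā²) as a root of the new x. The other two witnesses
  -- permute a, b, c in the numerator.
  refine Rat.concordant_of_int concordant_one_neg_three
    ((q₁ * p₂ * p₃ + 3 * q₁ * q₂ * q₃ - p₁ * p₂ * q₃ - p₁ * q₂ * p₃) / (2 * (p₁ * q₁)))
    ((p₁ * q₂ * p₃ + 3 * q₁ * q₂ * q₃ - p₁ * p₂ * q₃ - q₁ * p₂ * p₃) / (2 * (p₁ * q₁)))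
    ((p₁ * p₂ * q₃ + 3 * q₁ * q₂ * q₃ - q₁ * p₂ * p₃ - p₁ * q₂ * p₃) / (2 * (p₁ * q₁))) ?_ ?_
  · rw [div_pow, div_pow, div_add' _ _ _ h4]
    congr 1
    push_cast
    linear_combination 4 * (p₁ * q₂ - q₁ * p₂) * (3 * q₁ * q₂ - p₁ * p₂) * h3' +
      4 * (p₁ * q₁) * ((-p₁ ^ 2 - 3 * q₁ ^ 2) * h2' + p₁ * q₁ * h2)
  · rw [div_pow, div_pow, div_add' _ _ _ h4]
    congr 1
    push_cast
    linear_combination 4 * (p₁ * q₃ - q₁ * p₃) * (3 * q₁ * q₃ - p₁ * p₃) * h2' +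
      4 * (p₁ * q₁) * ((-p₁ ^ 2 - 3 * q₁ ^ 2) * h3' + p₁ * q₁ * h3)

theorem eq_zero_of_translates_eq_sq {p₁ q₁ p₂ q₂ p₃ q₃ : ℚ}
    (h2 : p₂ ^ 2 + 3 * q₂ ^ 2 = p₁ ^ 2 + 3 * q₁ ^ 2 + 1) (h2' : p₂ * q₂ = p₁ * q₁)
    (h3 : p₃ ^ 2 + 3 * q₃ ^ 2 = p₁ ^ 2 + 3 * q₁ ^ 2 - 3) (h3' : p₃ * q₃ = p₁ * q₁) :
    p₃ = 0 ∧ q₃ = 0 := by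
  have h1 := mul_eq_zero_of_translates_eq_sq h2 h2' h3 h3'
  rw [h1] at h2' h3'
  have hA := Rat.concordant_of_int concordant_one_neg_three
  have hB := Rat.concordant_of_int concordant_three_neg_nine
  push_cast at hA hB
  rcases mul_eq_zero.1 h1 with rfl | rfl <;> rcases mul_eq_zero.1 h2' with rfl | rfl <;>
    rcases mul_eq_zero.1 h3' with rfl | rfl
  -- All three values are multiples of √3; multiplying the equations by 3 gives the twisted pair.
  · exact (hB (3 * q₁) (3 * q₂) (3 * q₃) (by linarith) (by linarith)).elim
  · exact (Rat.one_add_sq_ne_three_mul_sq (p₃ / 2) (q₂ / 2) (by linarith)).elim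
  · refine ⟨rfl, ?_⟩
    by_contra hq
    -- Translation by the 2-torsion point (3, 0) sends x - 3 to 12/(x - 3) and makes all three roots
    -- rational.
    refine hA (p₂ / q₃) (2 * q₁ / q₃) (2 / q₃) ?_ ?_ <;> field_simp <;> linarith
  · refine ⟨?_, rfl⟩
    by_contra hp
    -- The same translation, followed by multiplication by 3.
    refine hB (3 * p₂ / p₃) (6 * q₁ / p₃) (6 / p₃) ?_ ?_ <;> field_simp <;> linarith
  · exact (Rat.one_add_sq_ne_three_mul_sq p₁ q₂ (by linarith)).elim
  · exact (Rat.one_add_sq_ne_three_mul_sq p₁ q₂ (by linarith)).elim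
  · exact (Rat.one_add_sq_ne_three_mul_sq q₃ (p₁ / 3) (by linarith)).elim
  · exact (hA p₁ p₂ p₃ (by linarith) (by linarith)).elim

theorem irrational_sqrt_three : Irrational √3 := by
  simpa using Nat.prime_three.irrational_sqrt

theorem coords_eq_of_add_mul_sqrt_three_eq {p q p' q' : ℚ}
    (h : (p + q * √3 : ℝ) = p' + q' * √3) : p = p' ∧ q = q' := by
  have hq : q = q' := by
    by_contra hne
    refine irrational_sqrt_three ⟨(p' - p) / (q - q'), ?_⟩
    have : (q - q' : ℝ) ≠ 0 := by exact_mod_cast sub_ne_zero.mpr hne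
    push_cast
    rw [div_eq_iff this]
    linarith
  subst hq
  exact ⟨by exact_mod_cast add_right_cancel h, rfl⟩

theorem exists_coords_of_mem_adjoin_sqrt_three {x : ℝ} (hx : x ∈ ℚ⟮√3⟯) :
    ∃ p q : ℚ, x = p + q * √3 := by
  have hs : √3 ^ 2 = 3 := Real.sq_sqrt (by norm_num)
  induction hx using IntermediateField.adjoin_induction with
  | mem x hx => exact ⟨0, 1, by simpa using hx⟩
  | algebraMap x => exact ⟨x, 0, by simp⟩
  | add x y _ _ hx hy =>
    obtain ⟨p, q, rfl⟩ := hx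
    obtain ⟨p', q', rfl⟩ := hy
    exact ⟨p + p', q + q', by push_cast; ring⟩
  | inv x _ hx =>
    obtain ⟨p, q, rfl⟩ := hx
    by_cases h : (p + q * √3 : ℝ) = 0
    · exact ⟨0, 0, by rw [h]; simp⟩
    have hn : (p - q * √3 : ℝ) ≠ 0 := by
      intro h0
      obtain ⟨rfl, hq⟩ := coords_eq_of_add_mul_sqrt_three_eq (p := p) (q := -q) (p' := 0) (q' := 0)
        (by push_cast; linarith)
      rw [neg_eq_zero.1 hq] at h
      simp at h
    have hn' : (p ^ 2 - 3 * q ^ 2 : ℝ) ≠ 0 := by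
      have := mul_ne_zero h hn
      intro h0; apply this; linear_combination h0 - (q : ℝ) ^ 2 * hs
    refine ⟨p / (p ^ 2 - 3 * q ^ 2), -q / (p ^ 2 - 3 * q ^ 2), ?_⟩
    push_cast
    apply inv_eq_of_mul_eq_one_right
    rw [show (p + q * √3 : ℝ) * (p / (p ^ 2 - 3 * q ^ 2) + -q / (p ^ 2 - 3 * q ^ 2) * √3) =
      (p ^ 2 - √3 ^ 2 * q ^ 2) / (p ^ 2 - 3 * q ^ 2) by ring, hs, div_self hn']
  | mul x y _ _ hx hy =>
    obtain ⟨p, q, rfl⟩ := hx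
    obtain ⟨p', q', rfl⟩ := hy
    exact ⟨p * p' + 3 * q * q', p * q' + q * p', by
      push_cast; linear_combination (q * q' : ℝ) * hs⟩

/-- The only `x` in `ℚ(√3)` for which `x²`, `x² + 1` and `x² - 3` are all squares in `ℚ(√3)` are
those with `x² = 3`. -/
theorem eq_zero_of_mem_adjoin_sqrt_three {a b c : ℝ} (ha : a ∈ ℚ⟮√3⟯) (hb : b ∈ ℚ⟮√3⟯)
    (hc : c ∈ ℚ⟮√3⟯) (h2 : b ^ 2 = a ^ 2 + 1) (h3 : c ^ 2 = a ^ 2 - 3) : c = 0 := by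
  have hs : √3 ^ 2 = 3 := Real.sq_sqrt (by norm_num)
  obtain ⟨p₁, q₁, rfl⟩ := exists_coords_of_mem_adjoin_sqrt_three ha
  obtain ⟨p₂, q₂, rfl⟩ := exists_coords_of_mem_adjoin_sqrt_three hb
  obtain ⟨p₃, q₃, rfl⟩ := exists_coords_of_mem_adjoin_sqrt_three hc
  obtain ⟨hb, hb'⟩ := coords_eq_of_add_mul_sqrt_three_eq (p := p₂ ^ 2 + 3 * q₂ ^ 2)
    (q := 2 * (p₂ * q₂)) (p' := p₁ ^ 2 + 3 * q₁ ^ 2 + 1) (q' := 2 * (p₁ * q₁))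
    (by push_cast; linear_combination h2 + (q₁ ^ 2 - q₂ ^ 2 : ℝ) * hs)
  obtain ⟨hc, hc'⟩ := coords_eq_of_add_mul_sqrt_three_eq (p := p₃ ^ 2 + 3 * q₃ ^ 2)
    (q := 2 * (p₃ * q₃)) (p' := p₁ ^ 2 + 3 * q₁ ^ 2 - 3) (q' := 2 * (p₁ * q₁))
    (by push_cast; linear_combination h3 + (q₁ ^ 2 - q₃ ^ 2 : ℝ) * hs)
  obtain ⟨rfl, rfl⟩ := eq_zero_of_translates_eq_sq hb (mul_left_cancel₀ two_ne_zero hb') hc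
    (mul_left_cancel₀ two_ne_zero hc')
  simp

/-! ### Doubling and 2-adic growth -/

/-- Rational points `(U, V, W)` with positive coordinates on `UV = 4N`, `W² = U² + V² + 4εN`. -/
def scaledTriangles (N ε : ℚ) : Set (ℚ × ℚ × ℚ) :=
  {t | 0 < t.1 ∧ 0 < t.2.1 ∧ 0 < t.2.2 ∧ t.1 * t.2.1 = 4 * N ∧
    t.2.2 ^ 2 = t.1 ^ 2 + t.2.1 ^ 2 + 4 * ε * N}

theorem padicNorm_two_natCast_le_one (n : ℕ) : padicNorm 2 n ≤ 1 := by
  exact_mod_cast padicNorm.of_int (p := 2) n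

theorem padicNorm_two_eight : padicNorm 2 8 = 1 / 8 := by
  rw [show (8 : ℚ) = ((2 : ℕ) : ℚ) * (2 : ℕ) * (2 : ℕ) by norm_num]
  simp only [padicNorm.mul, padicNorm.padicNorm_p_of_prime]; norm_num

theorem padicNorm_two_two : padicNorm 2 2 = 1 / 2 := by
  have := padicNorm.padicNorm_p_of_prime (p := 2)
  push_cast at this
  rw [this]; norm_num

/-- Doubling of the point corresponding to a triangle increases the `2`-adic norm of the side
opposite to the fixed angle. -/
theorem exists_double_mem_scaledTriangles {N ε U V W : ℚ} (hε : ε ^ 2 = 1) (hN : padicNorm 2 N ≤ 1)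
    (h : (U, V, W) ∈ scaledTriangles N ε) (hW : 1 ≤ padicNorm 2 W) :
    ∃ U' V' W', (U', V', W') ∈ scaledTriangles N ε ∧ padicNorm 2 W' = 2 * padicNorm 2 W := by
  obtain ⟨hU, hV, hW0, hUV, hsq⟩ := h
  dsimp only at hU hV hW0 hUV hsq
  set w := padicNorm 2 W with hw
  have hD : (U ^ 2 - V ^ 2) ^ 2 = W ^ 4 + 8 * (-(ε * N * W ^ 2) - 6 * N ^ 2) := by
    linear_combination (-(W ^ 2) - (U ^ 2 + V ^ 2 + 4 * ε * N) + 8 * ε * N) * hsq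
      - 4 * (U * V + 4 * N) * hUV + (16 * N ^ 2) * hε
  have hεn : padicNorm 2 ε = 1 := by
    have : padicNorm 2 ε ^ 2 = 1 := by rw [pow_two, ← padicNorm.mul, ← pow_two, hε, padicNorm.one]
    nlinarith [padicNorm.nonneg (p := 2) ε]
  have hpow : ∀ (x : ℚ) (n : ℕ), padicNorm 2 (x ^ n) = padicNorm 2 x ^ n := by
    intro x n
    induction n with
    | zero => simp
    | succ n ih => rw [pow_succ, padicNorm.mul, ih, pow_succ]
  have hN0 := padicNorm.nonneg (p := 2) N
  have hNN : padicNorm 2 N ^ 2 ≤ 1 := by nlinarith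
  have hw2 : 1 ≤ w ^ 2 := by nlinarith
  have hw4 : w ^ 2 ≤ w ^ 4 := by nlinarith
  have h6 : padicNorm 2 (6 * N ^ 2) ≤ 1 := by
    have := padicNorm_two_natCast_le_one 6
    push_cast at this
    rw [padicNorm.mul, hpow]
    nlinarith [padicNorm.nonneg (p := 2) 6]
  have hfirst : padicNorm 2 (-(ε * N * W ^ 2)) ≤ w ^ 2 := by
    rw [padicNorm.neg, padicNorm.mul, padicNorm.mul, hεn, hpow, ← hw]
    nlinarith
  have hsmall : padicNorm 2 (8 * (-(ε * N * W ^ 2) - 6 * N ^ 2)) < w ^ 4 := by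
    rw [padicNorm.mul, padicNorm_two_eight]
    have := padicNorm.sub (p := 2) (q := -(ε * N * W ^ 2)) (r := 6 * N ^ 2)
    have := max_le hfirst (h6.trans hw2)
    nlinarith
  have hsmall' : padicNorm 2 (8 * (6 * N ^ 2)) < w ^ 4 := by
    rw [padicNorm.mul, padicNorm_two_eight]
    nlinarith
  have hW4 : padicNorm 2 (W ^ 4) = w ^ 4 := hpow W 4
  have hDn : padicNorm 2 (U ^ 2 - V ^ 2) = w ^ 2 := by
    -- In `hD` the term W⁴ dominates 2-adically, because of the factor 8.
    have : padicNorm 2 (U ^ 2 - V ^ 2) ^ 2 = (w ^ 2) ^ 2 := by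
      rw [← hpow, hD, padicNorm.add_eq_max_of_ne (by rw [hW4]; exact hsmall.ne'), hW4,
        max_eq_left hsmall.le]
      ring
    exact (pow_left_inj₀ (padicNorm.nonneg _) (by positivity) two_ne_zero).1 this
  have hD0 : U ^ 2 - V ^ 2 ≠ 0 := by
    intro h0; rw [h0, padicNorm.zero] at hDn; linarith
  have hNpos : 0 < N := by have := mul_pos hU hV; linarith
  have habs : 0 < |U ^ 2 - V ^ 2| := abs_pos.mpr hD0
  have hD' : |U ^ 2 - V ^ 2| ^ 2 = W ^ 4 + 8 * (-(ε * N * W ^ 2) - 6 * N ^ 2) := by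
    rw [sq_abs, hD]
  have habsn : padicNorm 2 |U ^ 2 - V ^ 2| = w ^ 2 := by
    rcases abs_choice (U ^ 2 - V ^ 2) with h | h <;> simp only [h, padicNorm.neg, hDn]
  generalize |U ^ 2 - V ^ 2| = D at *
  -- Duplication with x = W²/4 and |y| = WD/8: the new W is 2(x² + 3N²)/(2|y|). Its numerator has
  -- norm w⁴ and its denominator w³/2.
  refine ⟨8 * N * W / D, D / (2 * W), (W ^ 4 + 8 * (6 * N ^ 2)) / (2 * W * D),
    ⟨by positivity, by positivity, by positivity, ?_, ?_⟩, ?_⟩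
  · dsimp only; field_simp; ring
  · dsimp only
    field_simp
    linear_combination (-(D ^ 2) - (W ^ 4 + 8 * (-(ε * N * W ^ 2) - 6 * N ^ 2))
      - 16 * ε * N * W ^ 2) * hD' + (64 * N ^ 2 * W ^ 4) * hε
  · rw [padicNorm.div, padicNorm.add_eq_max_of_ne (by rw [hW4]; exact hsmall'.ne'), hW4,
      max_eq_left hsmall'.le, padicNorm.mul, padicNorm.mul, padicNorm_two_two, habsn, ← hw]
    have : w ≠ 0 := by positivity
    field_simp

theorem infinite_scaledTriangles {N ε U V W : ℚ} (hε : ε ^ 2 = 1) (hN : padicNorm 2 N ≤ 1)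
    (h : (U, V, W) ∈ scaledTriangles N ε) (hW : 1 ≤ padicNorm 2 W) :
    (scaledTriangles N ε).Infinite := by
  intro hfin
  obtain ⟨⟨a, b, c⟩, hmem, hmax⟩ :=
    Set.exists_max_image _ (fun t : ℚ × ℚ × ℚ => padicNorm 2 t.2.2) hfin ⟨_, h⟩
  have hc : 1 ≤ padicNorm 2 c := hW.trans (hmax _ h)
  obtain ⟨a', b', c', hmem', hc'⟩ := exists_double_mem_scaledTriangles hε hN hmem hc
  have := hmax _ hmem'
  dsimp only at this
  linarith

/-! ### Triangles and their equations -/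

theorem isTriangleWith_of_law_cos {θ a u v w : ℝ} (h0 : 0 < θ) (hπ : θ < π) (hu : 0 < u)
    (hv : 0 < v) (hw : 0 ≤ w) (hcos : w ^ 2 = u ^ 2 + v ^ 2 - 2 * u * v * Real.cos θ)
    (ha : u * v * Real.sin θ / 2 = a) : IsTriangleWith θ a u v w := by
  have hsin : 0 < Real.sin θ := Real.sin_pos_of_pos_of_lt_pi h0 hπ
  have hsc := Real.sin_sq_add_cos_sq θ
  let A : EuclideanSpace ℝ (Fin 2) := !₂[u, 0]
  let B : EuclideanSpace ℝ (Fin 2) := !₂[v * Real.cos θ, v * Real.sin θ]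
  have hA : ‖A‖ = u := by
    rw [EuclideanSpace.norm_eq]
    simp [A, Real.sqrt_sq hu.le]
  have hB : ‖B‖ = v := by
    rw [EuclideanSpace.norm_eq, Real.sqrt_eq_iff_mul_self_eq (by positivity) hv.le]
    simp only [B, Fin.sum_univ_two, Real.norm_eq_abs, sq_abs,
      Matrix.cons_val_zero, Matrix.cons_val_one]
    linear_combination v ^ 2 * hsc
  have hangle : ∠ A 0 B = θ := by
    rw [EuclideanGeometry.angle, vsub_eq_sub, vsub_eq_sub, sub_zero, sub_zero,
      InnerProductGeometry.angle, hA, hB]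
    have : inner ℝ A B = u * v * Real.cos θ := by
      simp [A, B, PiLp.inner_apply, Fin.sum_univ_two]
      ring
    rw [this, mul_div_cancel_left₀ _ (by positivity), Real.arccos_cos h0.le hπ.le]
  have hA0 : A ≠ 0 := norm_ne_zero_iff.1 (by rw [hA]; exact hu.ne')
  have hB0 : B ≠ 0 := norm_ne_zero_iff.1 (by rw [hB]; exact hv.ne')
  have hdA : dist (0 : EuclideanSpace ℝ (Fin 2)) A = u := by rw [dist_zero_left, hA]
  have hdB : dist (0 : EuclideanSpace ℝ (Fin 2)) B = v := by rw [dist_zero_left, hB]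
  refine ⟨A, B, 0, ?_, hdA, hdB, ?_, hangle, ?_⟩
  · have hncol : ¬ Collinear ℝ {A, 0, B} := by
      rw [EuclideanGeometry.collinear_iff_eq_or_eq_or_sin_eq_zero, hangle]
      rintro (h | h | h)
      · exact hA0 h
      · exact hB0 h
      · exact hsin.ne' h
    rw [affineIndependent_iff_not_collinear_set]
    rwa [Set.pair_comm] at hncol
  · have := EuclideanGeometry.law_cos A 0 B
    rw [hangle, dist_comm A 0, dist_comm B 0, hdA, hdB] at this
    exact (pow_left_inj₀ dist_nonneg hw two_ne_zero).1 (by rw [hcos]; linarith)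
  · rw [triangleArea, hdA, hdB, hangle, ha]

theorem IsTriangleWith.law_cos {θ a u v w : ℝ} (h : IsTriangleWith θ a u v w) :
    0 < u ∧ 0 < v ∧ 0 < w ∧ w ^ 2 = u ^ 2 + v ^ 2 - 2 * u * v * Real.cos θ ∧
      u * v * Real.sin θ / 2 = a := by
  obtain ⟨A, B, C, hind, hu, hv, hw, hθ, ha⟩ := h
  have hinj := hind.injective
  have hCA : C ≠ A := fun h => absurd (@hinj 2 0 h) (by decide)
  have hCB : C ≠ B := fun h => absurd (@hinj 2 1 h) (by decide)
  have hAB : A ≠ B := fun h => absurd (@hinj 0 1 h) (by decide)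
  refine ⟨hu ▸ dist_pos.2 hCA, hv ▸ dist_pos.2 hCB, hw ▸ dist_pos.2 hAB, ?_, ?_⟩
  · have := EuclideanGeometry.law_cos A C B
    rw [hθ, dist_comm A C, dist_comm B C, hu, hv, hw] at this
    linarith
  · rw [← ha, triangleArea, hu, hv, hθ]

theorem Real.cos_two_pi_div_three : Real.cos (2 * π / 3) = -1 / 2 := by
  rw [show 2 * π / 3 = π - π / 3 by ring, Real.cos_pi_sub, Real.cos_pi_div_three]; norm_num

theorem Real.sin_two_pi_div_three : Real.sin (2 * π / 3) = √3 / 2 := by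
  rw [show 2 * π / 3 = π - π / 3 by ring, Real.sin_pi_sub, Real.sin_pi_div_three]

theorem mem_thetaTriangles_two_pi_div_three {K : IntermediateField ℚ ℝ} {n : ℕ} {u v w : ℝ}
    (hu : u ∈ K) (hv : v ∈ K) (hw : w ∈ K) (hu0 : 0 < u) (hv0 : 0 < v) (hw0 : 0 < w)
    (huv : u * v = 4 * n) (hsq : w ^ 2 = u ^ 2 + v ^ 2 + 4 * n) :
    (u, v, w) ∈ thetaTriangles K (2 * π / 3) n := by
  refine ⟨hu, hv, hw, 2, -1, by norm_num, isCoprime_one_right.neg_right, ?_, ?_⟩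
  · rw [Real.cos_two_pi_div_three]; norm_num
  · apply isTriangleWith_of_law_cos (by positivity) (by linarith [Real.pi_pos]) hu0 hv0 hw0.le
    · rw [Real.cos_two_pi_div_three]; linarith
    · rw [Real.sin_two_pi_div_three, huv]; norm_num; ring

theorem mem_thetaTriangles_pi_div_three {K : IntermediateField ℚ ℝ} {n : ℕ} {u v w : ℝ}
    (hu : u ∈ K) (hv : v ∈ K) (hw : w ∈ K) (hu0 : 0 < u) (hv0 : 0 < v) (hw0 : 0 < w)
    (huv : u * v = 4 * n) (hsq : w ^ 2 = u ^ 2 + v ^ 2 - 4 * n) :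
    (u, v, w) ∈ thetaTriangles K (π / 3) n := by
  refine ⟨hu, hv, hw, 2, 1, by norm_num, isCoprime_one_right, ?_, ?_⟩
  · rw [Real.cos_pi_div_three]; norm_num
  · apply isTriangleWith_of_law_cos (by positivity) (by linarith [Real.pi_pos]) hu0 hv0 hw0.le
    · rw [Real.cos_pi_div_three]; linarith
    · rw [Real.sin_pi_div_three, huv]; norm_num; ring

theorem eq_of_mem_thetaTriangles_sqrt_three {u v w : ℝ}
    (h : (u, v, w) ∈ thetaTriangles ℚ⟮√3⟯ (2 * π / 3) 1) : u = 2 ∧ v = 2 ∧ w = 2 * √3 := by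
  obtain ⟨hu, hv, hw, r, s, hr, hrs, hcos, htri⟩ := h
  dsimp only at hu hv hw htri
  obtain ⟨hu0, hv0, hw0, hlaw, harea⟩ := htri.law_cos
  rw [Real.cos_two_pi_div_three] at hcos hlaw
  rw [Real.sin_two_pi_div_three] at harea
  have hr' : (r : ℝ) ≠ 0 := by exact_mod_cast hr.ne'
  have hrs2 : r = -2 * s := by
    field_simp at hcos
    have : (r : ℝ) = -2 * s := by linarith
    exact_mod_cast this
  have hs : s = -1 := by
    have : IsUnit s := hrs.isUnit_of_dvd' ⟨-2, by rw [hrs2]; ring⟩ dvd_rfl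
    rcases Int.isUnit_iff.1 this with h | h <;> omega
  subst hs
  obtain rfl : r = 2 := by omega
  have h3 : ((2 : ℤ) : ℝ) ^ 2 - ((-1 : ℤ) : ℝ) ^ 2 = 3 := by norm_num
  rw [h3] at harea
  have hs3 : 0 < √3 := by positivity
  have huv : u * v = 4 := by
    apply mul_right_cancel₀ hs3.ne'
    push_cast at harea
    linarith
  have h2 : (2 : ℝ) ∈ ℚ⟮√3⟯ := ofNat_mem _ 2
  -- Here a = w/2, b = (u+v)/2, c = (u-v)/2.
  have hzero := eq_zero_of_mem_adjoin_sqrt_three (div_mem hw h2) (div_mem (add_mem hu hv) h2)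
    (div_mem (sub_mem hu hv) h2) (by linarith) (by linarith)
  obtain rfl : u = v := by linarith
  have hu2 : u = 2 := by nlinarith
  subst hu2
  refine ⟨rfl, rfl, (pow_left_inj₀ hw0.le (by positivity) two_ne_zero).1 ?_⟩
  rw [mul_pow, Real.sq_sqrt (by norm_num), hlaw]; norm_num

/-- Scaling by `√d` maps rational solutions for `n / d` injectively to triangles over `ℚ(√d)`. -/
theorem infinite_of_infinite_scaledTriangles {d n : ℕ} {θ : ℝ} {ε : ℚ} (hd : 0 < d)
    (hmem : ∀ u v w : ℝ, u ∈ ℚ⟮√d⟯ → v ∈ ℚ⟮√d⟯ → w ∈ ℚ⟮√d⟯ → 0 < u → 0 < v → 0 < w →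
      u * v = 4 * n → w ^ 2 = u ^ 2 + v ^ 2 + 4 * ε * n → (u, v, w) ∈ thetaTriangles ℚ⟮√d⟯ θ n)
    (hinf : (scaledTriangles (n / d) ε).Infinite) : IsProperlyThetaCongruent ℚ⟮√d⟯ θ n := by
  have hd' : (0 : ℝ) < d := by exact_mod_cast hd
  have hsq : √(d : ℝ) ^ 2 = d := Real.sq_sqrt hd'.le
  have hpos : 0 < √(d : ℝ) := Real.sqrt_pos.2 hd'
  have hcast : ∀ q : ℚ, (q * √d : ℝ) ∈ ℚ⟮√(d : ℝ)⟯ := fun q =>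
    mul_mem (SubfieldClass.ratCast_mem _ q) (IntermediateField.mem_adjoin_simple_self ℚ _)
  have hinj : ∀ q q' : ℚ, (q * √d : ℝ) = q' * √d → q = q' := fun q q' h => by
    exact_mod_cast mul_right_cancel₀ hpos.ne' h
  refine Set.infinite_of_injOn_mapsTo
    (f := fun t : ℚ × ℚ × ℚ => ((t.1 * √d : ℝ), (t.2.1 * √d : ℝ), (t.2.2 * √d : ℝ))) ?_ ?_ hinf
  · rintro ⟨a, b, c⟩ - ⟨a', b', c'⟩ - h
    simp only [Prod.mk.injEq] at h
    rw [hinj _ _ h.1, hinj _ _ h.2.1, hinj _ _ h.2.2]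
  · rintro ⟨a, b, c⟩ ⟨ha, hb, hc, hab, hlaw⟩
    dsimp only at ha hb hc hab hlaw ⊢
    have hab' : (a * b : ℝ) = 4 * (n / d) := by
      simpa using congrArg (Rat.cast : ℚ → ℝ) hab
    have hlaw' : (c ^ 2 : ℝ) = a ^ 2 + b ^ 2 + 4 * ε * (n / d) := by
      simpa using congrArg (Rat.cast : ℚ → ℝ) hlaw
    have hnd : (n / d : ℝ) * d = n := div_mul_cancel₀ _ hd'.ne'
    refine hmem _ _ _ (hcast a) (hcast b) (hcast c) (mul_pos (by exact_mod_cast ha) hpos)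
      (mul_pos (by exact_mod_cast hb) hpos) (mul_pos (by exact_mod_cast hc) hpos) ?_ ?_
    · linear_combination (a * b : ℝ) * hsq + (d : ℝ) * hab' + 4 * hnd
    · linear_combination (c ^ 2 - a ^ 2 - b ^ 2 : ℝ) * hsq + (d : ℝ) * hlaw' + 4 * (ε : ℝ) * hnd

/-! ### The explicit examples -/

theorem padicNorm_two_of_odd_div_odd {a b : ℕ} (ha : a % 2 = 1) (hb : b % 2 = 1) :
    padicNorm 2 ((a : ℚ) / b) = 1 := by
  have h : ∀ m : ℕ, m % 2 = 1 → padicNorm 2 (m : ℚ) = 1 := fun m hm =>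
    (padicNorm.nat_eq_one_iff m).2 (by omega)
  rw [padicNorm.div, h a ha, h b hb, div_one]

theorem padicNorm_two_div_odd_le_one (a : ℕ) {b : ℕ} (hb : b % 2 = 1) :
    padicNorm 2 ((a : ℚ) / b) ≤ 1 := by
  rw [padicNorm.div, (padicNorm.nat_eq_one_iff (p := 2) b).2 (by omega), div_one]
  exact padicNorm_two_natCast_le_one a

theorem isProperlyThetaCongruent_pi_div_three {d n : ℕ} {U V W : ℚ} (hd : d % 2 = 1)
    (h : (U, V, W) ∈ scaledTriangles (n / d) (-1)) (hW : 1 ≤ padicNorm 2 W) :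
    IsProperlyThetaCongruent ℚ⟮√d⟯ (π / 3) n :=
  infinite_of_infinite_scaledTriangles (ε := -1) (by omega)
    (fun u v w hu hv hw hu0 hv0 hw0 huv hsq =>
      mem_thetaTriangles_pi_div_three hu hv hw hu0 hv0 hw0 huv (by push_cast at hsq; linarith))
    (infinite_scaledTriangles (by norm_num) (padicNorm_two_div_odd_le_one n hd) h hW)

theorem isProperlyThetaCongruent_two_pi_div_three {d n : ℕ} {U V W : ℚ} (hd : d % 2 = 1)
    (h : (U, V, W) ∈ scaledTriangles (n / d) 1) (hW : 1 ≤ padicNorm 2 W) :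
    IsProperlyThetaCongruent ℚ⟮√d⟯ (2 * π / 3) n :=
  infinite_of_infinite_scaledTriangles (ε := 1) (by omega)
    (fun u v w hu hv hw hu0 hv0 hw0 huv hsq =>
      mem_thetaTriangles_two_pi_div_three hu hv hw hu0 hv0 hw0 huv (by push_cast at hsq; linarith))
    (infinite_scaledTriangles (by norm_num) (padicNorm_two_div_odd_le_one n hd) h hW)

theorem theorem4 :
    (IsThetaCongruent ℚ⟮√3⟯ (2 * π / 3) 1 ∧ ¬ IsProperlyThetaCongruent ℚ⟮√3⟯ (2 * π / 3) 1) ∧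
    (IsProperlyThetaCongruent ℚ⟮√13⟯ (π / 3) 3 ∧
      (√13 / 2, 24 * √13 / 13, 43 * √13 / 26) ∈ thetaTriangles ℚ⟮√13⟯ (π / 3) 3) ∧
    (IsProperlyThetaCongruent ℚ⟮√7⟯ (2 * π / 3) 2 ∧
      (3 * √7 / 7, 8 * √7 / 3, 61 * √7 / 21) ∈ thetaTriangles ℚ⟮√7⟯ (2 * π / 3) 2) ∧
    (IsProperlyThetaCongruent ℚ⟮√5⟯ (π / 3) 6 ∧
      (8 * √5 / 5, 3 * √5, 13 * √5 / 5) ∈ thetaTriangles ℚ⟮√5⟯ (π / 3) 6) := by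
  have hgen : ∀ x : ℝ, x ∈ ℚ⟮x⟯ := fun x => IntermediateField.mem_adjoin_simple_self ℚ x
  refine ⟨⟨⟨(2, 2, 2 * √3), ?_⟩, fun hinf => hinf ?_⟩, ⟨?_, ?_⟩, ⟨?_, ?_⟩, ⟨?_, ?_⟩⟩
  · refine mem_thetaTriangles_two_pi_div_three (ofNat_mem _ 2) (ofNat_mem _ 2)
      (mul_mem (ofNat_mem _ 2) (hgen _)) (by norm_num) (by norm_num) (by positivity) (by norm_num) ?_
    rw [mul_pow, Real.sq_sqrt (by norm_num)]; norm_num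
  · refine (Set.finite_singleton ((2, 2, 2 * √3) : ℝ × ℝ × ℝ)).subset ?_
    rintro ⟨u, v, w⟩ h
    obtain ⟨rfl, rfl, rfl⟩ := eq_of_mem_thetaTriangles_sqrt_three h
    rfl
  · refine isProperlyThetaCongruent_pi_div_three (d := 13) (n := 3)
      -- The given triangle divided by √13; W = 43/26 is split so that the odd part matches
      -- `padicNorm_two_of_odd_div_odd`.
      (U := 1 / 2) (V := 24 / 13) (W := (43 : ℕ) / (13 : ℕ) / 2) rfl
      ⟨by norm_num, by norm_num, by norm_num, by norm_num, by norm_num⟩ ?_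
    rw [padicNorm.div, padicNorm_two_of_odd_div_odd rfl rfl, padicNorm_two_two]; norm_num
  · have hs : √13 ^ 2 = (13 : ℝ) := Real.sq_sqrt (by norm_num)
    refine mem_thetaTriangles_pi_div_three (div_mem (hgen _) (ofNat_mem _ 2))
      (div_mem (mul_mem (ofNat_mem _ 24) (hgen _)) (ofNat_mem _ 13))
      (div_mem (mul_mem (ofNat_mem _ 43) (hgen _)) (ofNat_mem _ 26))
      (by positivity) (by positivity) (by positivity) ?_ ?_ <;> push_cast <;> linarith
  · refine isProperlyThetaCongruent_two_pi_div_three (d := 7) (n := 2)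
      (U := 3 / 7) (V := 8 / 3) (W := (61 : ℕ) / (21 : ℕ)) rfl
      ⟨by norm_num, by norm_num, by norm_num, by norm_num, by norm_num⟩ ?_
    rw [padicNorm_two_of_odd_div_odd rfl rfl]
  · have hs : √7 ^ 2 = (7 : ℝ) := Real.sq_sqrt (by norm_num)
    refine mem_thetaTriangles_two_pi_div_three
      (div_mem (mul_mem (ofNat_mem _ 3) (hgen _)) (ofNat_mem _ 7))
      (div_mem (mul_mem (ofNat_mem _ 8) (hgen _)) (ofNat_mem _ 3))
      (div_mem (mul_mem (ofNat_mem _ 61) (hgen _)) (ofNat_mem _ 21))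
      (by positivity) (by positivity) (by positivity) ?_ ?_ <;> push_cast <;> linarith
  · refine isProperlyThetaCongruent_pi_div_three (d := 5) (n := 6)
      (U := 8 / 5) (V := 3) (W := (13 : ℕ) / (5 : ℕ)) rfl
      ⟨by norm_num, by norm_num, by norm_num, by norm_num, by norm_num⟩ ?_
    rw [padicNorm_two_of_odd_div_odd rfl rfl]
  · have hs : √5 ^ 2 = (5 : ℝ) := Real.sq_sqrt (by norm_num)
    refine mem_thetaTriangles_pi_div_three
      (div_mem (mul_mem (ofNat_mem _ 8) (hgen _)) (ofNat_mem _ 5))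
      (mul_mem (ofNat_mem _ 3) (hgen _))
      (div_mem (mul_mem (ofNat_mem _ 13) (hgen _)) (ofNat_mem _ 5))
      (by positivity) (by positivity) (by positivity) ?_ ?_ <;> push_cast <;> linarith
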